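/- **Theorem 1.2.** Let $G$ be a gossip network: a finite directed graph with a positive rate $w_e$ on each edge $e$ and a distinguished source node $v_s$ that has an edge to every other node. Let the edges carry mutually independent Poisson clocks, the clock on $e$ having rate $w_e$. Each node $v$ maintains a timestamp $N_v(t)$, $t\ge 0$, where $N_v(0)=0$ for all $v$ and $N_{v_s}(t)=t$ for all $t$; whenever the clock on an edge $(u,v)$ rings at time $t$, $N_v(t)$ is updated to $\max\{N_v(t),N_u(t)\}$, and timestamps of nodes other than $v_s$ do not change otherwise. The age of information of $v$ at time $t$ is $X_v(t)=t-N_v(t)$. Let $G'$ be the graph obtained from $G$ by reversing all edges, and give its edges independent exponential weights $\tau_e$, the weight $\tau_{(j,i)}$ of the reversal of an edge $(i,j)$ of $G$ having rate $w_{(i,j)}$. For nodes $u,v$ let $T(u,v)=\min_\gamma\sum_{e\in\gamma}\tau_e$, where the minimum is over all directed paths $\gamma$ from $u$ to $v$ in $G'$ (with $T(v,v)=0$). Then for every time $t\ge 0$ and every node $v$, $$X_v(t)\ \overset{d}{=}\ \min\{T(v,v_s),\,t\}.$$ Consequently, for every node $v$, $X_v(t)$ converges in distribution to $T(v,v_s)$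 as $t\to\infty$. -/

import Mathlib

open MeasureTheory ProbabilityTheory Filter
open scoped NNReal

namespace Gossip

/-- A weighted directed graph on the node set `N`: a directed graph together with a positive rate
on every edge.  Values of `rate` at pairs that are not edges play no role. -/
structure WeightedDigraph (N : Type*) extends Digraph N where
  rate : N → N → ℝ≥0
  rate_pos : ∀ ⦃u v : N⦄, Adj u v → 0 < rate u v

/-- The edges of `G`; the edge `e` goes from `e.1.1` to `e.1.2`. -/
abbrev WeightedDigraph.Edge {N : Type*} (G : WeightedDigraph N) : Type _ :=
  {e : N × N // G.Adj e.1 e.2}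

/-- The graph with all edges reversed: the rate of the reversed edge `(u, v)` is the original rate
of `(v, u)`. -/
def WeightedDigraph.reverse {N : Type*} (G : WeightedDigraph N) : WeightedDigraph N where
  Adj u v := G.Adj v u
  rate u v := G.rate v u
  rate_pos _ _ h := G.rate_pos h

/-- A gossip network: a weighted directed graph with a distinguished source node that has an edge
to every other node. -/
structure GossipNetwork (N : Type*) extends WeightedDigraph N where
  source : N
  source_adj : ∀ v, v ≠ source → Adj source v

/-! ### First passage percolation -/

/-- `G.IsPath γ u v`: the list `γ` of edges is a path from `u` to `v`, that is, it starts at `u`,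
each edge starts where the previous one ended, and it ends at `v`.  The empty list is the path from
a node to itself. -/
def WeightedDigraph.IsPath {N : Type*} (G : WeightedDigraph N) : List G.Edge → N → N → Prop
  | [], u, v => u = v
  | e :: γ, u, v => e.1.1 = u ∧ G.IsPath γ e.1.2 v

/-- The passage time of a path, for edge weights `τ`. -/
def WeightedDigraph.pathTime {N : Type*} (G : WeightedDigraph N) (τ : G.Edge → ℝ)
    (γ : List G.Edge) : ℝ :=
  (γ.map τ).sum

/-- The first passage time `T(u, v)` for edge weights `τ`: the least passage time of a path from
`u` to `v`. By `isLeast_passageTime` the infimum is a minimum when the graph is finite, the weights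
are non-negative and `v` can be reached from `u`. -/
noncomputable def WeightedDigraph.passageTime {N : Type*} (G : WeightedDigraph N)
    (τ : G.Edge → ℝ) (u v : N) : ℝ :=
  sInf {x | ∃ γ, G.IsPath γ u v ∧ G.pathTime τ γ = x}

theorem WeightedDigraph.isPath_append {N : Type*} (G : WeightedDigraph N) (a b : List G.Edge)
    (u v : N) : G.IsPath (a ++ b) u v ↔ ∃ w, G.IsPath a u w ∧ G.IsPath b w v := by
  induction a generalizing u with
  | nil => simp [IsPath]
  | cons e a ih =>
    simp only [List.cons_append, IsPath, ih]
    grind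

theorem WeightedDigraph.exists_nodup_path {N : Type*} (G : WeightedDigraph N) (τ : G.Edge → ℝ)
    (hτ : ∀ e, 0 ≤ τ e) (γ : List G.Edge) (u v : N) (h : G.IsPath γ u v) :
    ∃ γ', γ'.Nodup ∧ G.IsPath γ' u v ∧ G.pathTime τ γ' ≤ G.pathTime τ γ := by
  induction γ generalizing u with
  | nil => exact ⟨[], List.nodup_nil, h, le_rfl⟩
  | cons e γ ih =>
    obtain ⟨γ', hn, hp, ht⟩ := ih _ h.2
    by_cases he : e ∈ γ'
    · obtain ⟨a, b, rfl⟩ := List.append_of_mem he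
      obtain ⟨w, -, hw⟩ := (G.isPath_append _ _ _ _).1 hp
      refine ⟨e :: b, hn.sublist (List.sublist_append_right _ _), ⟨h.1, hw.2⟩, ?_⟩
      have ha : 0 ≤ (a.map τ).sum := List.sum_nonneg (by simp only [List.mem_map]; grind)
      have := hτ e
      simp only [pathTime, List.map_append, List.map_cons, List.sum_append, List.sum_cons] at ht ⊢
      linarith
    · refine ⟨e :: γ', List.nodup_cons.2 ⟨he, hn⟩, ⟨h.1, hp⟩, ?_⟩
      simpa [pathTime] using ht

theorem WeightedDigraph.isLeast_passageTime {N : Type*} [Finite N] (G : WeightedDigraph N)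
    (τ : G.Edge → ℝ) (hτ : ∀ e, 0 ≤ τ e) (u v : N) (h : ∃ γ, G.IsPath γ u v) :
    IsLeast {x | ∃ γ, G.IsPath γ u v ∧ G.pathTime τ γ = x} (G.passageTime τ u v) := by
  have hfin : {γ : List G.Edge | γ.Nodup ∧ G.IsPath γ u v}.Finite :=
    Set.Finite.subset (s := {γ : List G.Edge | γ.Nodup})
      (haveI := Fintype.ofFinite G.Edge
       Set.finite_coe_iff.1 (Finite.of_fintype {γ : List G.Edge // γ.Nodup})) fun _ h => h.1
  obtain ⟨γ₀, h₀⟩ := h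
  obtain ⟨γ₁, h₁, h₁', -⟩ := G.exists_nodup_path τ hτ γ₀ u v h₀
  obtain ⟨γ, hγ, hmin⟩ := hfin.exists_minimalFor (G.pathTime τ) _ ⟨γ₁, h₁, h₁'⟩
  have key : IsLeast {x | ∃ γ, G.IsPath γ u v ∧ G.pathTime τ γ = x} (G.pathTime τ γ) := by
    refine ⟨⟨γ, hγ.2, rfl⟩, ?_⟩
    rintro x ⟨δ, hδ, rfl⟩
    obtain ⟨δ', hn, hp, ht⟩ := G.exists_nodup_path τ hτ δ u v hδ
    rcases le_total (G.pathTime τ γ) (G.pathTime τ δ') with hle | hle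
    · exact hle.trans ht
    · exact (hmin ⟨hn, hp⟩ hle).trans ht
  rw [passageTime, key.csInf_eq]
  exact key

/-! ### Poisson clocks -/

/-- `C` is (the counting process of) a homogeneous Poisson process of rate `r` on `[0, ∞)`: almost
surely it starts at `0` and is non-decreasing and right-continuous, it has independent increments,
and its increment over `(s, t]` is Poisson distributed with mean `r * (t - s)`. -/
structure IsPoissonProcess {Ω : Type*} [MeasurableSpace Ω] (C : ℝ≥0 → Ω → ℕ) (r : ℝ≥0)
    (P : Measure Ω) : Prop where
  measurable : ∀ t, Measurable (C t)
  zero : ∀ᵐ ω ∂P, C 0 ω = 0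
  mono : ∀ᵐ ω ∂P, Monotone fun t => C t ω
  right_continuous : ∀ᵐ ω ∂P, ∀ t, ContinuousWithinAt (fun s => C s ω) (Set.Ici t) t
  indep_increments : HasIndepIncrements C P
  increment_law : ∀ s t, s ≤ t → HasLaw (fun ω => C t ω - C s ω) (poissonMeasure (r * (t - s))) P

/-- Mutually independent Poisson clocks on the edges of `G`, the clock on `(u, v)` having rate
`G.rate u v`. -/
structure IsPoissonClocks {N Ω : Type*} [MeasurableSpace Ω] (G : WeightedDigraph N)
    (C : G.Edge → ℝ≥0 → Ω → ℕ) (P : Measure Ω) : Prop where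
  poisson : ∀ e : G.Edge, IsPoissonProcess (C e) (G.rate e.1.1 e.1.2) P
  indep : iIndepFun (fun e ω t => C e t ω) P

/-- Mutually independent exponential weights on the edges of `G`, the weight of `(u, v)` having
rate `G.rate u v`. -/
structure IsExponentialWeights {N Ω : Type*} [MeasurableSpace Ω] (G : WeightedDigraph N)
    (τ : G.Edge → Ω → ℝ) (P : Measure Ω) : Prop where
  law : ∀ e : G.Edge, HasLaw (τ e) (expMeasure (G.rate e.1.1 e.1.2)) P
  indep : iIndepFun τ P

/-! ### The age process -/

/-- The times at which a clock with counting function `c` rings, i.e. the jump times of `c`. -/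
def ringTimes (c : ℝ≥0 → ℕ) : Set ℝ≥0 :=
  {t | 0 < t ∧ ∀ s < t, c s < c t}

open Classical in
/-- The timestamps right after time `r`, when `σ` gives the timestamps right before time `r` and
some clocks may ring at time `r`: the source always holds the current time `r`, and each edge
`(u, v)` whose clock rings at time `r` replaces the timestamp of `v` by the maximum of those of
`u` and `v`. -/
noncomputable def GossipNetwork.step {N : Type*} [Fintype N] (G : GossipNetwork N)
    (c : G.Edge → ℝ≥0 → ℕ) (σ : N → ℝ≥0) (r : ℝ≥0) : N → ℝ≥0 :=
  let σ' := Function.update σ G.source r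
  fun v => max (σ' v)
    ((Finset.univ.filter fun u => ∃ h : G.Adj u v, r ∈ ringTimes (c ⟨(u, v), h⟩)).sup σ')

open Classical in
/-- The times in `[0, t]` at which some clock rings, in increasing order.  (There are finitely many
of them almost surely; the value on the exceptional null event is irrelevant.) -/
noncomputable def GossipNetwork.eventList {N : Type*} (G : GossipNetwork N)
    (c : G.Edge → ℝ≥0 → ℕ) (t : ℝ≥0) : List ℝ≥0 :=
  if h : {r | r ≤ t ∧ ∃ e, r ∈ ringTimes (c e)}.Finite then h.toFinset.sort (· ≤ ·) else []

open Classical in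
/-- The timestamp `N_v(t)` of the most recent packet seen by `v` at time `t`, when the clocks on the
edges have counting functions `c`: all timestamps are `0` at time `0`, then the updates are
performed at the ring times in `[0, t]` in chronological order; the source has timestamp `t`. -/
noncomputable def GossipNetwork.timestamp {N : Type*} [Fintype N] (G : GossipNetwork N)
    (c : G.Edge → ℝ≥0 → ℕ) (t : ℝ≥0) (v : N) : ℝ≥0 :=
  Function.update ((G.eventList c t).foldl (G.step c) fun _ => 0) G.source t v

/-- The age of information `X_v(t) = t - N_v(t)`. -/
noncomputable def GossipNetwork.age {N : Type*} [Fintype N] (G : GossipNetwork N)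
    (c : G.Edge → ℝ≥0 → ℕ) (t : ℝ≥0) (v : N) : ℝ :=
  (t : ℝ) - G.timestamp c t v

end Gossip

namespace Gossip

open scoped ENNReal Topology

/-! ### Spreading along edges and first passage percolation -/

section Spread

variable {N : Type*} (G : WeightedDigraph N)

/-! Write t = a + x with 0 < x ≤ t. The age of v at time t is below x exactly when N_v(a + x) > a,
that is, when information leaving the source after time a has reached v by time a + x. This is a
growth process started at the source and run for time x. Since the clocks are memoryless, it should
be first passage percolation on G from the source, and reading paths backwards turns this into T(v,
v_s) on the reversed graph.

The comparison is made by discretisation. Cut (a, a + x] into n windows of length h = x/n. The sets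
of edges ringing in the windows are independent, and each is distributed as the set of edges whose
exponential weight is at most h (`map_windowRings`). Two clocks share a window with probability
O(1/n) (`tendsto_measure_clash`). Otherwise v is informed exactly when n rounds of spreading along
the ringing edges reach it (`lt_timestamp_iff`), and `spreadProb` is the probability of that.

On the percolation side, redrawing after time h the weights of the edges out of the informed set S
that have not yet transmitted leaves the weight law unchanged (`map_restart_weightLaw`). Induction
on the rounds then bounds `spreadProb` above by P(T ≤ nh) (`spreadProb_le`) and below by P(T ≤ (n -
|Sᶜ|)h) (`weightLaw_reachedBy_le_spreadProb`), because rounding costs time only in rounds that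
enlarge S.

Letting n tend to infinity gives P(T ≤ y) ≤ P(X_v(t) < x) ≤ P(T ≤ x) for y < x, which determines the
law (`measure_eq_of_Iic_le`). The limit in t follows since min(T, t) = T as soon as t ≥ T. -/

/-- The nodes that are informed once the edges in `R` have transmitted simultaneously, when the
nodes in `S` were informed before. -/
def WeightedDigraph.spread (S : Set N) (R : G.Edge → Prop) : Set N :=
  S ∪ {y | ∃ e : G.Edge, R e ∧ e.1.1 ∈ S ∧ e.1.2 = y}

/-- Some path from a node of `S` to `v` has passage time at most `x`. -/
def WeightedDigraph.ReachedBy (τ : G.Edge → ℝ) (S : Set N) (v : N) (x : ℝ) : Prop :=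
  ∃ u ∈ S, ∃ γ, G.IsPath γ u v ∧ G.pathTime τ γ ≤ x

variable {G}

theorem subset_spread (S : Set N) (R : G.Edge → Prop) : S ⊆ G.spread S R :=
  Set.subset_union_left

theorem mem_spread_of_edge {S : Set N} {R : G.Edge → Prop} {e : G.Edge} (he : R e)
    (h : e.1.1 ∈ S) : e.1.2 ∈ G.spread S R :=
  Or.inr ⟨e, he, h, rfl⟩

theorem pathTime_cons (τ : G.Edge → ℝ) (e : G.Edge) (γ : List G.Edge) :
    G.pathTime τ (e :: γ) = τ e + G.pathTime τ γ := by
  simp [WeightedDigraph.pathTime]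

theorem pathTime_nonneg {τ : G.Edge → ℝ} (hτ : ∀ e, 0 ≤ τ e) (γ : List G.Edge) :
    0 ≤ G.pathTime τ γ :=
  List.sum_nonneg (by simp only [List.mem_map]; grind)

theorem pathTime_congr {τ τ' : G.Edge → ℝ} {γ : List G.Edge} (h : ∀ e ∈ γ, τ e = τ' e) :
    G.pathTime τ γ = G.pathTime τ' γ := by
  rw [WeightedDigraph.pathTime, WeightedDigraph.pathTime, List.map_congr_left h]

/-- Cutting a path at its last exit from `S`. -/
theorem exists_exit_path {τ : G.Edge → ℝ} (hτ : ∀ e, 0 ≤ τ e) {S : Set N} {v : N} (hv : v ∉ S)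
    (γ : List G.Edge) (u : N) (hγ : G.IsPath γ u v) (hS : ∃ f ∈ γ, f.1.1 ∈ S) :
    ∃ e γ', e.1.1 ∈ S ∧ e.1.2 ∉ S ∧ G.IsPath γ' e.1.2 v ∧ (∀ f ∈ γ', f.1.1 ∉ S) ∧
      τ e + G.pathTime τ γ' ≤ G.pathTime τ γ := by
  induction γ generalizing u with
  | nil => simp at hS
  | cons e γ ih =>
    rw [pathTime_cons]
    by_cases h : ∃ f ∈ γ, f.1.1 ∈ S
    · obtain ⟨e', γ', h1, h2, h3, h4, h5⟩ := ih _ hγ.2 h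
      exact ⟨e', γ', h1, h2, h3, h4, by linarith [hτ e]⟩
    · push Not at h
      refine ⟨e, γ, ?_, ?_, hγ.2, h, le_rfl⟩
      · obtain ⟨f, hf, hfS⟩ := hS
        rcases List.mem_cons.1 hf with rfl | hf
        · exact hfS
        · exact absurd hfS (h f hf)
      · rcases γ with _ | ⟨f, γ⟩
        · exact fun h' => hv (hγ.2 ▸ h')
        · rw [← hγ.2.1]
          exact h f List.mem_cons_self

theorem reachedBy_exit {τ : G.Edge → ℝ} (hτ : ∀ e, 0 ≤ τ e) {S : Set N} {v : N} (hv : v ∉ S)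
    {x : ℝ} (h : G.ReachedBy τ S v x) :
    ∃ e γ, e.1.1 ∈ S ∧ e.1.2 ∉ S ∧ G.IsPath γ e.1.2 v ∧ (∀ f ∈ γ, f.1.1 ∉ S) ∧
      τ e + G.pathTime τ γ ≤ x := by
  obtain ⟨u, hu, γ, hγ, hx⟩ := h
  have hS : ∃ f ∈ γ, f.1.1 ∈ S := by
    rcases γ with _ | ⟨f, γ⟩
    · exact absurd (hγ ▸ hu) hv
    · exact ⟨f, List.mem_cons_self, hγ.1 ▸ hu⟩
  obtain ⟨e, γ', h1, h2, h3, h4, h5⟩ := exists_exit_path hτ hv γ u hγ hS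
  exact ⟨e, γ', h1, h2, h3, h4, h5.trans hx⟩

theorem reachedBy_of_mem {τ : G.Edge → ℝ} {S : Set N} {v : N} (hv : v ∈ S) {x : ℝ} (hx : 0 ≤ x) :
    G.ReachedBy τ S v x :=
  ⟨v, hv, [], rfl, by simpa [WeightedDigraph.pathTime] using hx⟩

theorem reachedBy_mono {τ : G.Edge → ℝ} {S S' : Set N} (hS : S ⊆ S') {v : N} {x x' : ℝ}
    (hx : x ≤ x') (h : G.ReachedBy τ S v x) : G.ReachedBy τ S' v x' := by
  obtain ⟨u, hu, γ, hγ, h⟩ := h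
  exact ⟨u, hS hu, γ, hγ, h.trans hx⟩

open Classical in
/-- Edge weights obtained from `σ` by restarting at time `h`, with fresh weights `τ`, the edges out
of `S` that have not transmitted by then; all other edges out of `S` keep the weight `σ`, and the
edges that do not start in `S` get the fresh weight. -/
noncomputable def WeightedDigraph.restart (G : WeightedDigraph N) (S : Set N) (h : ℝ)
    (σ τ : G.Edge → ℝ) (e : G.Edge) : ℝ :=
  if e.1.1 ∈ S then (if σ e ≤ h then σ e else h + τ e) else τ e

/-- Follow the path from its last exit from the enlarged set; beyond that edge both weightings
agree. If the exit edge starts in S, its restarted weight exceeds the fresh one by at most h. If it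
starts at a newly informed node, prepending the edge that informed this node costs at most h. -/
theorem reachedBy_restart_of_spread {S : Set N} {h x : ℝ} (hh : 0 ≤ h) (hx : 0 ≤ x)
    {σ τ : G.Edge → ℝ} (hτ : ∀ e, 0 ≤ τ e) {v : N}
    (H : G.ReachedBy τ (G.spread S fun e => σ e ≤ h) v x) :
    G.ReachedBy (G.restart S h σ τ) S v (x + h) := by
  by_cases hvS : v ∈ S
  · exact reachedBy_of_mem hvS (by positivity)
  by_cases hv : v ∈ G.spread S fun e => σ e ≤ h
  · obtain hv | ⟨e, he, heS, rfl⟩ := hv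
    · exact absurd hv hvS
    · refine ⟨e.1.1, heS, [e], ⟨rfl, rfl⟩, ?_⟩
      simp [WeightedDigraph.pathTime, WeightedDigraph.restart, heS, he]
      linarith
  obtain ⟨e, γ, h1, -, h3, h4, h5⟩ := reachedBy_exit hτ hv H
  have hγ : G.pathTime (G.restart S h σ τ) γ = G.pathTime τ γ :=
    pathTime_congr fun f hf =>
      if_neg fun hS => h4 f hf (subset_spread _ _ hS)
  by_cases heS : e.1.1 ∈ S
  · refine ⟨e.1.1, heS, e :: γ, ⟨rfl, h3⟩, ?_⟩
    rw [pathTime_cons, hγ]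
    have := hτ e
    simp only [WeightedDigraph.restart, heS, if_true]
    split_ifs <;> linarith
  · obtain h1 | ⟨f, hf, hfS, hfe⟩ := h1
    · exact absurd h1 heS
    · refine ⟨f.1.1, hfS, f :: e :: γ, ⟨rfl, hfe.symm, h3⟩, ?_⟩
      rw [pathTime_cons, pathTime_cons, hγ]
      simp only [WeightedDigraph.restart, heS, hfS, if_true, if_false, if_pos hf]
      linarith

/-- The last exit edge from S decides. If it has not transmitted by h, its weight contains a full h,
which can be deducted. If it has, no time is deducted, but its endpoint is new; this can happen at
most |Sᶜ| times over all rounds. -/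
theorem reachedBy_spread_of_restart {S : Set N} {h x : ℝ} (hh : 0 ≤ h)
    {σ τ : G.Edge → ℝ} (hσ : ∀ e, 0 ≤ σ e) (hτ : ∀ e, 0 ≤ τ e) {v : N} (hv : v ∉ S)
    (H : G.ReachedBy (G.restart S h σ τ) S v x) :
    G.ReachedBy τ (G.spread S fun e => σ e ≤ h) v (x - h) ∨
      S ≠ G.spread S (fun e => σ e ≤ h) ∧
        G.ReachedBy τ (G.spread S fun e => σ e ≤ h) v x := by
  have hr : ∀ e, 0 ≤ G.restart S h σ τ e := fun e => by
    have := hσ e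
    have := hτ e
    simp only [WeightedDigraph.restart]
    split_ifs <;> linarith
  obtain ⟨e, γ, h1, h2, h3, h4, h5⟩ := reachedBy_exit hr hv H
  rw [pathTime_congr (τ' := τ) fun f hf => by simp [WeightedDigraph.restart, h4 f hf]] at h5
  simp only [WeightedDigraph.restart, h1, if_true] at h5
  by_cases he : σ e ≤ h
  · have hmem : e.1.2 ∈ G.spread S fun e => σ e ≤ h := mem_spread_of_edge he h1
    refine Or.inr ⟨fun heq => h2 (heq ▸ hmem), e.1.2, hmem, γ, h3, ?_⟩
    rw [if_pos he] at h5
    linarith [hσ e]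
  · refine Or.inl ⟨e.1.1, subset_spread _ _ h1, e :: γ, ⟨rfl, h3⟩, ?_⟩
    rw [if_neg he] at h5
    rw [pathTime_cons]
    linarith

end Spread

/-! ### Laws of passage times and of rounds of spreading -/

section PassageLaw

theorem expMeasure_Iic {r : ℝ} (hr : 0 < r) (x : ℝ) :
    expMeasure r (Set.Iic x) = ENNReal.ofReal (if 0 ≤ x then 1 - Real.exp (-(r * x)) else 0) := by
  have := isProbabilityMeasure_expMeasure hr
  rw [← ofReal_cdf, cdf_expMeasure_eq hr]

theorem ae_nonneg_expMeasure {r : ℝ} (hr : 0 < r) : ∀ᵐ x ∂expMeasure r, 0 ≤ x := by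
  have h : expMeasure r (⋃ n : ℕ, Set.Iic (-(1 / ((n : ℝ) + 1)))) = 0 := by
    refine measure_iUnion_null fun n => ?_
    have : 0 < 1 / ((n : ℝ) + 1) := by positivity
    rw [expMeasure_Iic hr, if_neg (by linarith), ENNReal.ofReal_zero]
  refine measure_mono_null (fun x hx => ?_) h
  have hx : x < 0 := not_le.1 hx
  obtain ⟨n, hn⟩ := exists_nat_one_div_lt (neg_pos.2 hx)
  exact Set.mem_iUnion.2 ⟨n, by simp only [Set.mem_Iic]; linarith⟩

/-- The lack of memory of the exponential distribution. -/
theorem map_restart_expMeasure {r : ℝ} (hr : 0 < r) {h : ℝ} (hh : 0 ≤ h) :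
    ((expMeasure r).prod (expMeasure r)).map
      (fun p : ℝ × ℝ => if p.1 ≤ h then p.1 else h + p.2) = expMeasure r := by
  have := isProbabilityMeasure_expMeasure hr
  have hm : Measurable (fun p : ℝ × ℝ => if p.1 ≤ h then p.1 else h + p.2) :=
    Measurable.ite (measurableSet_le measurable_fst measurable_const) (by fun_prop) (by fun_prop)
  have := Measure.isProbabilityMeasure_map (μ := (expMeasure r).prod (expMeasure r)) hm.aemeasurable
  refine Measure.ext_of_Iic _ _ fun x => ?_
  rw [Measure.map_apply hm measurableSet_Iic]
  have hset : (fun p : ℝ × ℝ => if p.1 ≤ h then p.1 else h + p.2) ⁻¹' Set.Iic x =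
      Set.Iic (min x h) ×ˢ Set.univ ∪ Set.Ioi h ×ˢ Set.Iic (x - h) := by
    ext p
    simp only [Set.mem_preimage, Set.mem_Iic, Set.mem_union, Set.mem_prod, Set.mem_univ,
      Set.mem_Ioi, le_min_iff]
    split_ifs with hp
    · simp [hp]
    · simp [hp, not_le.1 hp, le_sub_iff_add_le']
  have hdisj : Disjoint (Set.Iic (min x h) ×ˢ (Set.univ : Set ℝ))
      (Set.Ioi h ×ˢ Set.Iic (x - h)) := by
    refine Set.disjoint_left.2 fun p hp hp' => ?_
    simp only [Set.mem_prod, Set.mem_Iic, Set.mem_Ioi, le_min_iff] at hp hp'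
    linarith [hp.1.2, hp'.1]
  have hIoi : expMeasure r (Set.Ioi h) = ENNReal.ofReal (Real.exp (-(r * h))) := by
    rw [← Set.compl_Iic, prob_compl_eq_one_sub measurableSet_Iic, expMeasure_Iic hr, if_pos hh,
      ← ENNReal.ofReal_one, ← ENNReal.ofReal_sub _ (by
        simp only [sub_nonneg, Real.exp_le_one_iff, Left.neg_nonpos_iff]; positivity)]
    congr 1
    ring
  rw [hset, measure_union hdisj (measurableSet_Ioi.prod measurableSet_Iic), Measure.prod_prod,
    Measure.prod_prod, measure_univ, mul_one, hIoi]
  simp only [expMeasure_Iic hr]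
  rcases lt_or_ge x h with hxh | hxh
  · rw [min_eq_left hxh.le, if_neg (by linarith : ¬ 0 ≤ x - h)]
    simp
  · rw [min_eq_right hxh, if_pos (by linarith), if_pos (by linarith), if_pos (by linarith),
      ← ENNReal.ofReal_mul (by positivity), ← ENNReal.ofReal_add]
    · congr 1
      -- (1 - exp(-rh)) + exp(-rh)(1 - exp(-r(x - h))) telescopes to 1 - exp(-rx).
      rw [mul_sub, mul_one, ← Real.exp_add]
      ring_nf
    · simp only [sub_nonneg, Real.exp_le_one_iff, Left.neg_nonpos_iff]; positivity
    · refine mul_nonneg (by positivity) ?_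
      simp only [sub_nonneg, Real.exp_le_one_iff, Left.neg_nonpos_iff]
      exact mul_nonneg hr.le (by linarith)

variable {N : Type*} {G : WeightedDigraph N}

theorem measurable_pathTime (γ : List G.Edge) : Measurable fun τ => G.pathTime τ γ := by
  induction γ with
  | nil => simp [WeightedDigraph.pathTime]
  | cons e γ ih =>
    simp only [pathTime_cons]
    exact (measurable_pi_apply e).add ih

theorem measurable_restart (S : Set N) (h : ℝ) :
    Measurable fun p : (G.Edge → ℝ) × (G.Edge → ℝ) => G.restart S h p.1 p.2 := by
  classical
  refine measurable_pi_lambda _ fun e => ?_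
  by_cases he : e.1.1 ∈ S
  · simp only [WeightedDigraph.restart, he, if_true]
    exact Measurable.ite (measurableSet_le (by fun_prop) measurable_const)
      (by fun_prop) (by fun_prop)
  · simp only [WeightedDigraph.restart, he, if_false]
    fun_prop

theorem measurable_le_edges (h : ℝ) : Measurable fun (τ : G.Edge → ℝ) e => τ e ≤ h :=
  measurable_pi_lambda _ fun e => measurableSet_setOfPred.1
    (measurableSet_le (measurable_pi_apply e) measurable_const)

variable [Fintype N] (G)

noncomputable instance WeightedDigraph.fintypeEdge : Fintype G.Edge := Fintype.ofFinite _

instance WeightedDigraph.isProbabilityMeasure_expMeasure_rate (e : G.Edge) :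
    IsProbabilityMeasure (expMeasure (G.rate e.1.1 e.1.2)) :=
  isProbabilityMeasure_expMeasure (NNReal.coe_pos.2 (G.rate_pos e.2))

/-- The law of independent exponential weights on the edges of `G`. -/
noncomputable def WeightedDigraph.weightLaw : Measure (G.Edge → ℝ) :=
  Measure.pi fun e => expMeasure (G.rate e.1.1 e.1.2)

instance : IsProbabilityMeasure G.weightLaw := by
  rw [WeightedDigraph.weightLaw]; infer_instance

/-- The law of the set of edges with weight at most `h`, for independent exponential weights. -/
noncomputable def WeightedDigraph.ringLaw (h : ℝ) : Measure (G.Edge → Prop) :=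
  G.weightLaw.map fun τ e => τ e ≤ h

instance (h : ℝ) : IsProbabilityMeasure (G.ringLaw h) :=
  Measure.isProbabilityMeasure_map (measurable_le_edges h).aemeasurable

open Classical in
/-- The probability that `v` is informed after `n` rounds of spreading from `S` along independent
random sets of edges with law `G.ringLaw h`. -/
noncomputable def WeightedDigraph.spreadProb (G : WeightedDigraph N) (h : ℝ) (v : N) :
    ℕ → Set N → ℝ≥0∞
  | 0, S => if v ∈ S then 1 else 0
  | n + 1, S => ∫⁻ R, G.spreadProb h v n (G.spread S R) ∂G.ringLaw h

variable {G}

theorem ae_nonneg_weightLaw : ∀ᵐ τ ∂G.weightLaw, ∀ e, 0 ≤ τ e :=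
  ae_all_iff.2 fun e => (Measure.tendsto_eval_ae_ae (i := e)).eventually
    (ae_nonneg_expMeasure (NNReal.coe_pos.2 (G.rate_pos e.2)))

theorem measurableSet_reachedBy (S : Set N) (v : N) (x : ℝ) :
    MeasurableSet {τ | G.ReachedBy τ S v x} := by
  have : {τ | G.ReachedBy τ S v x} =
      ⋃ γ ∈ {γ | ∃ u ∈ S, G.IsPath γ u v}, {τ | G.pathTime τ γ ≤ x} := by
    ext τ
    simp only [WeightedDigraph.ReachedBy, Set.mem_ofPred_eq, Set.mem_iUnion]
    grind
  rw [this]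
  exact MeasurableSet.biUnion (Set.to_countable _) fun γ _ =>
    measurableSet_le (measurable_pathTime γ) measurable_const

/-- The restart acts edge by edge: out of S it is the lack of memory, elsewhere it is a projection
onto the fresh weight. -/
theorem map_restart_weightLaw (S : Set N) {h : ℝ} (hh : 0 ≤ h) :
    (G.weightLaw.prod G.weightLaw).map (fun p => G.restart S h p.1 p.2) = G.weightLaw := by
  classical
  let f : (e : G.Edge) → ℝ × ℝ → ℝ := fun e p =>
    if e.1.1 ∈ S then (if p.1 ≤ h then p.1 else h + p.2) else p.2
  have hf : ∀ e, Measurable (f e) := fun e => by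
    by_cases he : e.1.1 ∈ S
    · simp only [f, he, if_true]
      exact Measurable.ite (measurableSet_le measurable_fst measurable_const)
        (by fun_prop) (by fun_prop)
    · simp only [f, he, if_false]
      fun_prop
  have hf' : ∀ e : G.Edge, ((expMeasure (G.rate e.1.1 e.1.2)).prod
      (expMeasure (G.rate e.1.1 e.1.2))).map (f e) = expMeasure (G.rate e.1.1 e.1.2) := fun e => by
    by_cases he : e.1.1 ∈ S
    · simp only [f, he, if_true]
      exact map_restart_expMeasure (NNReal.coe_pos.2 (G.rate_pos e.2)) hh
    · simp only [f, he, if_false]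
      exact Measure.map_snd_prod.trans (by simp)
  have hp := measurePreserving_arrowProdEquivProdArrow ℝ ℝ G.Edge
    (fun e => expMeasure (G.rate e.1.1 e.1.2)) (fun e => expMeasure (G.rate e.1.1 e.1.2))
  rw [WeightedDigraph.weightLaw, ← hp.map_eq,
    Measure.map_map (measurable_restart S h) (by fun_prop)]
  refine (Measure.pi_map_pi (f := f) (hμ := fun e => by rw [hf' e]; infer_instance)
    fun e => (hf e).aemeasurable).trans ?_
  simp only [hf']

/-- Fubini: the first weights enter only through the set of edges that transmit. The time budget `y`
may depend on the enlarged set, as the lower bound on `spreadProb` requires. -/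
theorem prod_weightLaw_reachedBy (y : Set N → ℝ) (S : Set N) (v : N) (h : ℝ) :
    (G.weightLaw.prod G.weightLaw) {p | G.ReachedBy p.2 (G.spread S fun e => p.1 e ≤ h) v
      (y (G.spread S fun e => p.1 e ≤ h))} =
    ∫⁻ R, G.weightLaw {τ | G.ReachedBy τ (G.spread S R) v (y (G.spread S R))} ∂G.ringLaw h := by
  have hm : MeasurableSet {p : (G.Edge → Prop) × (G.Edge → ℝ) |
      G.ReachedBy p.2 (G.spread S p.1) v (y (G.spread S p.1))} := by
    refine measurableSet_setOfPred.2 (measurable_from_prod_countable_right fun R => ?_)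
    exact measurableSet_setOfPred.1 (measurableSet_reachedBy (G.spread S R) v (y (G.spread S R)))
  rw [WeightedDigraph.ringLaw, lintegral_map (measurable_of_countable _) (measurable_le_edges h)]
  exact Measure.prod_apply (hm.preimage
    (((measurable_le_edges h).comp measurable_fst).prodMk measurable_snd))

theorem ae_nonneg_prod_weightLaw : ∀ᵐ p ∂G.weightLaw.prod G.weightLaw,
    (∀ e, 0 ≤ p.1 e) ∧ ∀ e, 0 ≤ p.2 e :=
  (Measure.quasiMeasurePreserving_fst.ae ae_nonneg_weightLaw).and
    (Measure.quasiMeasurePreserving_snd.ae ae_nonneg_weightLaw)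

theorem weightLaw_reachedBy_eq (S : Set N) (v : N) {h : ℝ} (hh : 0 ≤ h) (x : ℝ) :
    G.weightLaw {τ | G.ReachedBy τ S v x} =
      (G.weightLaw.prod G.weightLaw) {p | G.ReachedBy (G.restart S h p.1 p.2) S v x} := by
  conv_lhs => rw [← map_restart_weightLaw S hh]
  exact Measure.map_apply (measurable_restart S h) (measurableSet_reachedBy _ _ _)

theorem spreadProb_le (v : N) {h : ℝ} (hh : 0 ≤ h) (n : ℕ) (S : Set N) :
    G.spreadProb h v n S ≤ G.weightLaw {τ | G.ReachedBy τ S v (n * h)} := by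
  induction n generalizing S with
  | zero =>
    simp only [WeightedDigraph.spreadProb]
    split_ifs with hv
    · simp [reachedBy_of_mem hv le_rfl]
    · simp
  | succ n ih =>
    simp only [WeightedDigraph.spreadProb]
    refine (lintegral_mono fun R => ih _).trans ?_
    rw [weightLaw_reachedBy_eq S v hh, ← prod_weightLaw_reachedBy (fun _ => n * h)]
    refine measure_mono_ae ?_
    filter_upwards [ae_nonneg_prod_weightLaw] with p hp H
    have := reachedBy_restart_of_spread hh (by positivity) hp.2 H
    show G.ReachedBy _ _ _ _
    convert this using 1
    push_cast
    ring

theorem spreadProb_of_mem {v : N} (h : ℝ) (n : ℕ) {S : Set N} (hv : v ∈ S) :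
    G.spreadProb h v n S = 1 := by
  induction n generalizing S with
  | zero => simp [WeightedDigraph.spreadProb, hv]
  | succ n ih => simp [WeightedDigraph.spreadProb, ih (subset_spread _ _ hv)]

theorem weightLaw_reachedBy_of_neg (S : Set N) (v : N) {x : ℝ} (hx : x < 0) :
    G.weightLaw {τ | G.ReachedBy τ S v x} = 0 := by
  refine measure_mono_null ?_ (ae_iff.1 (ae_nonneg_weightLaw (G := G)))
  rintro τ ⟨u, -, γ, -, hγ⟩ hτ
  linarith [pathTime_nonneg hτ γ]

/-- The term |Sᶜ| counts the rounds that may still be wasted. A round either takes h off the time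
budget or informs a new node and lowers |Sᶜ|; both preserve the bound on `x`. -/
theorem weightLaw_reachedBy_le_spreadProb (v : N) {h : ℝ} (hh : 0 < h) (n : ℕ) (S : Set N) (x : ℝ)
    (hx : x ≤ (n - (Sᶜ.ncard : ℝ)) * h) :
    G.weightLaw {τ | G.ReachedBy τ S v x} ≤ G.spreadProb h v n S := by
  induction n generalizing S x with
  | zero =>
    by_cases hv : v ∈ S
    · rw [spreadProb_of_mem h 0 hv]
      exact prob_le_one
    have : 0 < Sᶜ.ncard := (Set.ncard_pos (Set.toFinite _)).2 ⟨v, hv⟩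
    -- With no rounds left and v uninformed, the budget is at most -|Sᶜ|h < 0.
    rw [weightLaw_reachedBy_of_neg]
    · exact zero_le
    · have : (0 : ℝ) < Sᶜ.ncard := by exact_mod_cast this
      push_cast at hx
      nlinarith
  | succ n ih =>
    by_cases hv : v ∈ S
    · rw [spreadProb_of_mem h _ hv]
      exact prob_le_one
    simp only [WeightedDigraph.spreadProb]
    refine le_trans ?_ (lintegral_mono fun R => ih (G.spread S R) _ le_rfl)
    rw [weightLaw_reachedBy_eq S v hh.le,
      ← prod_weightLaw_reachedBy (fun S' => (n - (S'ᶜ.ncard : ℝ)) * h)]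
    refine measure_mono_ae ?_
    filter_upwards [ae_nonneg_prod_weightLaw] with p hp H
    push_cast at hx
    rcases reachedBy_spread_of_restart hh.le hp.1 hp.2 hv H with H | ⟨hne, H⟩
    · refine reachedBy_mono subset_rfl ?_ H
      have : (G.spread S fun e => p.1 e ≤ h)ᶜ.ncard ≤ Sᶜ.ncard :=
        Set.ncard_le_ncard (Set.compl_subset_compl.2 (subset_spread _ _))
      have : ((G.spread S fun e => p.1 e ≤ h)ᶜ.ncard : ℝ) ≤ Sᶜ.ncard := by exact_mod_cast this
      nlinarith
    · refine reachedBy_mono subset_rfl ?_ H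
      have : (G.spread S fun e => p.1 e ≤ h)ᶜ.ncard < Sᶜ.ncard :=
        Set.ncard_lt_ncard (compl_lt_compl_iff_lt.2 ((subset_spread _ _).ssubset_of_ne hne))
      have : ((G.spread S fun e => p.1 e ≤ h)ᶜ.ncard : ℝ) + 1 ≤ Sᶜ.ncard := by exact_mod_cast this
      nlinarith

end PassageLaw

/-! ### The age process for a fixed realisation of the clocks -/

section Clock

variable {c : ℝ≥0 → ℕ}

theorem lt_of_mem_ringTimes (hc : Monotone c) {s r s' : ℝ≥0} (hr : r ∈ ringTimes c) (hs : s < r)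
    (hs' : r ≤ s') : c s < c s' :=
  (hr.2 s hs).trans_le (hc hs')

/-- The ring time is the infimum of the times at which the final value has been attained.
Right-continuity with values in a discrete space makes this infimum attained. -/
theorem exists_ringTime (hc : Monotone c) (hrc : ∀ t, ContinuousWithinAt c (Set.Ici t) t)
    {s s' : ℝ≥0} (h : c s < c s') : ∃ r ∈ ringTimes c, s < r ∧ r ≤ s' := by
  let A : Set ℝ≥0 := {u | c s' ≤ c u}
  have hs' : s' ∈ A := le_refl (c s')
  have hA : c s' ≤ c (sInf A) := by
    have h1 : ∀ᶠ u in 𝓝[≥] (sInf A), c u = c (sInf A) :=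
      hrc (sInf A) ((isOpen_discrete {c (sInf A)}).mem_nhds rfl)
    obtain ⟨b, hb, hb'⟩ := (mem_nhdsGE_iff_exists_Ico_subset (a := sInf A)).1 h1
    obtain ⟨u, hu, hub⟩ := exists_lt_of_csInf_lt ⟨s', hs'⟩ hb
    rw [← show c u = c (sInf A) from hb' ⟨csInf_le' hu, hub⟩]
    exact hu
  have hs : s < sInf A := by
    by_contra hle
    exact absurd (hA.trans (hc (not_lt.1 hle))) (not_le.2 h)
  refine ⟨sInf A, ⟨(zero_le (a := s)).trans_lt hs, fun u hu => ?_⟩, hs, csInf_le' hs'⟩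
  exact (not_le.1 fun hu' => notMem_of_lt_csInf' hu hu').trans_le hA

theorem finite_ringTimes_le (hc : Monotone c) (t : ℝ≥0) : {r | r ≤ t ∧ r ∈ ringTimes c}.Finite := by
  refine Set.Finite.of_finite_image (f := c) ((Set.finite_Iic (c t)).subset ?_) ?_
  · rintro _ ⟨r, hr, rfl⟩
    exact hc hr.1
  · intro r hr r' hr' h
    rcases lt_trichotomy r r' with hlt | rfl | hlt
    · exact absurd h (hr'.2.2 r hlt).ne
    · rfl
    · exact absurd h (hr.2.2 r' hlt).ne'

end Clock

section Network

/-- This lets one clock ring repeatedly within a window without harm. -/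
theorem spread_spread_eq {N : Type*} {G : WeightedDigraph N} (S : Set N) (e : G.Edge) :
    G.spread (G.spread S (· = e)) (· = e) = G.spread S (· = e) := by
  ext y
  simp only [WeightedDigraph.spread, Set.mem_union, Set.mem_ofPred_eq]
  grind

variable {N : Type*} {G : GossipNetwork N} {c : G.Edge → ℝ≥0 → ℕ}

/-- The nodes informed after `n` rounds of spreading from `S`, where the edges in `R k` transmit in
round `k`. -/
def WeightedDigraph.spreadSeq (G : WeightedDigraph N) (S : Set N) (R : ℕ → G.Edge → Prop) :
    ℕ → Set N
  | 0 => S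
  | n + 1 => G.spread (G.spreadSeq S R n) (R n)

theorem le_of_mem_eventList {t r : ℝ≥0} (hr : r ∈ G.eventList c t) : r ≤ t := by
  unfold GossipNetwork.eventList at hr
  split_ifs at hr with h
  · exact ((Set.Finite.mem_toFinset h).1 ((Finset.mem_sort _).1 hr)).1
  · simp at hr

variable [Fintype N]

theorem finite_events (hc : ∀ e, Monotone (c e)) (t : ℝ≥0) :
    {r | r ≤ t ∧ ∃ e, r ∈ ringTimes (c e)}.Finite := by
  refine (Set.finite_iUnion fun e => finite_ringTimes_le (hc e) t).subset ?_
  rintro r ⟨hr, e, he⟩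
  exact Set.mem_iUnion.2 ⟨e, hr, he⟩

theorem eventList_eq_append (hc : ∀ e, Monotone (c e)) {s t : ℝ≥0} (hst : s ≤ t) :
    ∃ W, G.eventList c t = G.eventList c s ++ W ∧
      ∀ r, r ∈ W ↔ s < r ∧ r ≤ t ∧ ∃ e, r ∈ ringTimes (c e) := by
  have ht := finite_events hc t
  have hs := finite_events hc s
  have hW : {r | s < r ∧ r ≤ t ∧ ∃ e, r ∈ ringTimes (c e)}.Finite :=
    ht.subset fun r hr => hr.2
  refine ⟨hW.toFinset.sort (· ≤ ·), ?_, fun r => by simp⟩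
  rw [GossipNetwork.eventList, GossipNetwork.eventList, dif_pos ht, dif_pos hs]
  refine List.Perm.eq_of_pairwise' (r := (· ≤ ·)) (Finset.pairwise_sort _ _)
    (List.pairwise_append.2 ⟨Finset.pairwise_sort _ _, Finset.pairwise_sort _ _, ?_⟩) ?_
  · intro a ha b hb
    simp only [Finset.mem_sort, Set.Finite.mem_toFinset, Set.mem_ofPred_eq] at ha hb
    exact ha.1.trans hb.1.le
  · refine (List.perm_ext_iff_of_nodup (Finset.sort_nodup _ _)
      ((Finset.sort_nodup _ _).append (Finset.sort_nodup _ _) ?_)).2 fun r => ?_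
    · intro a ha hb
      simp only [Finset.mem_sort, Set.Finite.mem_toFinset, Set.mem_ofPred_eq] at ha hb
      exact absurd ha.1 (not_le.2 hb.1)
    · simp only [List.mem_append, Finset.mem_sort, Set.Finite.mem_toFinset, Set.mem_ofPred_eq]
      constructor
      · rintro ⟨h1, h2⟩
        rcases le_or_gt r s with h | h
        · exact Or.inl ⟨h, h2⟩
        · exact Or.inr ⟨h, h1, h2⟩
      · rintro (⟨h1, h2⟩ | ⟨-, h⟩)
        · exact ⟨h1.trans hst, h2⟩
        · exact h

theorem step_le {σ : N → ℝ≥0} {r b : ℝ≥0} (hσ : ∀ u, σ u ≤ b) (hr : r ≤ b) (u : N) :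
    G.step c σ r u ≤ b := by
  classical
  have h : ∀ u, Function.update σ G.source r u ≤ b := fun u => by
    rw [Function.update_apply]
    split_ifs
    exacts [hr, hσ u]
  exact max_le (h u) (Finset.sup_le fun w _ => h w)

theorem foldl_step_le {L : List ℝ≥0} {b : ℝ≥0} (hL : ∀ r ∈ L, r ≤ b) {σ : N → ℝ≥0}
    (hσ : ∀ u, σ u ≤ b) (u : N) : L.foldl (G.step c) σ u ≤ b := by
  induction L generalizing σ with
  | nil => exact hσ u
  | cons r L ih =>
    exact ih (fun r' hr' => hL r' (List.mem_cons_of_mem _ hr'))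
      (step_le hσ (hL r List.mem_cons_self))

theorem timestamp_le (t : ℝ≥0) (v : N) : G.timestamp c t v ≤ t := by
  classical
  rw [GossipNetwork.timestamp, Function.update_apply]
  split_ifs
  · exact le_rfl
  · exact foldl_step_le (fun r hr => le_of_mem_eventList hr) (fun _ => zero_le) v

theorem age_nonneg (t : ℝ≥0) (v : N) : 0 ≤ G.age c t v :=
  sub_nonneg.2 (NNReal.coe_le_coe.2 (timestamp_le t v))

theorem age_le (t : ℝ≥0) (v : N) : G.age c t v ≤ t :=
  sub_le_self _ (NNReal.coe_nonneg _)

/-- The nodes with timestamp later than `a`, where the source always counts as one. -/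
def GossipNetwork.later (G : GossipNetwork N) (a : ℝ≥0) (σ : N → ℝ≥0) : Set N :=
  {u | u = G.source ∨ a < σ u}

/-- Comparison with a threshold commutes with maxima, so updates become spreading of a set. The
stored source timestamp may be stale, which is why `later` counts the source unconditionally. -/
theorem later_step {a r : ℝ≥0} (h : a < r) (σ : N → ℝ≥0) :
    G.later a (G.step c σ r) = G.spread (G.later a σ) fun e => r ∈ ringTimes (c e) := by
  classical
  have key : ∀ u, a < Function.update σ G.source r u ↔ u ∈ G.later a σ := fun u => by
    rw [Function.update_apply]
    split_ifs with hu <;> simp [GossipNetwork.later, hu, h]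
  ext y
  have hy : a < G.step c σ r y ↔ y ∈ G.spread (G.later a σ) fun e => r ∈ ringTimes (c e) := by
    simp only [GossipNetwork.step, lt_max_iff, key, Finset.lt_sup_iff, Finset.mem_filter,
      Finset.mem_univ, true_and, WeightedDigraph.spread, Set.mem_union, Set.mem_ofPred_eq]
    refine or_congr_right ⟨?_, ?_⟩
    · rintro ⟨u, ⟨hu, hr⟩, hl⟩
      exact ⟨⟨(u, y), hu⟩, hr, hl, rfl⟩
    · rintro ⟨⟨⟨u, w⟩, hu⟩, hr, hl, rfl⟩
      exact ⟨u, ⟨hu, hr⟩, hl⟩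
  rw [← hy]
  refine or_iff_right_of_imp fun hs => ?_
  rw [hy, hs]
  exact subset_spread _ _ (Or.inl rfl)

theorem later_foldl_step {a : ℝ≥0} {L : List ℝ≥0} (hL : ∀ r ∈ L, a < r) (σ : N → ℝ≥0) :
    G.later a (L.foldl (G.step c) σ) =
      L.foldl (fun S r => G.spread S fun e => r ∈ ringTimes (c e)) (G.later a σ) := by
  induction L generalizing σ with
  | nil => rfl
  | cons r L ih =>
    rw [List.foldl_cons, List.foldl_cons, ← later_step (hL r List.mem_cons_self),
      ih fun r' hr' => hL r' (List.mem_cons_of_mem _ hr')]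

/-- All events in the window belong to a single edge, so by idempotence they act as one
transmission; without events both sides are unchanged. -/
theorem later_eventList (hc : ∀ e, Monotone (c e))
    (hrc : ∀ e t, ContinuousWithinAt (c e) (Set.Ici t) t) {a s s' : ℝ≥0} (has : a ≤ s)
    (hss' : s ≤ s') (hone : ∀ e f, c e s < c e s' → c f s < c f s' → e = f) :
    G.later a ((G.eventList c s').foldl (G.step c) fun _ => 0) =
      G.spread (G.later a ((G.eventList c s).foldl (G.step c) fun _ => 0))
        fun e => c e s < c e s' := by
  obtain ⟨W, hW, hmem⟩ := eventList_eq_append (G := G) hc hss'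
  rw [hW, List.foldl_append, later_foldl_step fun r hr => has.trans_lt ((hmem r).1 hr).1]
  generalize G.later a ((G.eventList c s).foldl (G.step c) fun _ => 0) = S
  by_cases he : ∃ e, c e s < c e s'
  · obtain ⟨e, he⟩ := he
    have hR : (fun e => c e s < c e s') = (· = e) := by
      ext f
      exact ⟨fun hf => hone f e hf he, fun hf => hf ▸ he⟩
    have hring : ∀ r ∈ W, (fun e => r ∈ ringTimes (c e)) = (· = e) := fun r hr => by
      obtain ⟨h1, h2, e', he'⟩ := (hmem r).1 hr
      have hall : ∀ f, r ∈ ringTimes (c f) → f = e := fun f hf =>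
        hone f e (lt_of_mem_ringTimes (hc f) hf h1 h2) he
      ext f
      exact ⟨hall f, fun hf => hf ▸ hall e' he' ▸ he'⟩
    have hne : W ≠ [] := by
      obtain ⟨r, hr, h1, h2⟩ := exists_ringTime (hc e) (hrc e) he
      exact List.ne_nil_of_mem ((hmem r).2 ⟨h1, h2, e, hr⟩)
    have hfold : ∀ L : List ℝ≥0, (∀ r ∈ L, r ∈ W) →
        L.foldl (fun S r => G.spread S fun e => r ∈ ringTimes (c e)) (G.spread S (· = e)) =
          G.spread S (· = e) := fun L hL => by
      induction L with
      | nil => rfl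
      | cons r L ih =>
        rw [List.foldl_cons, hring r (hL r List.mem_cons_self), spread_spread_eq,
          ih fun r' hr' => hL r' (List.mem_cons_of_mem _ hr')]
    obtain ⟨r, L, rfl⟩ := List.exists_cons_of_ne_nil hne
    rw [List.foldl_cons, hring r List.mem_cons_self, hR,
      hfold L fun r' hr' => List.mem_cons_of_mem _ hr']
  · have : W = [] := List.eq_nil_iff_forall_not_mem.2 fun r hr => by
      obtain ⟨h1, h2, e, hr⟩ := (hmem r).1 hr
      exact he ⟨e, lt_of_mem_ringTimes (hc e) hr h1 h2⟩
    push Not at he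
    simp [this, WeightedDigraph.spread, fun e => not_lt.2 (he e)]

/-- If at most one clock rings in each window `(s k, s (k + 1)]`, the nodes with timestamp later
than `s 0` are those reached by spreading along the edges that ring in successive windows. -/
theorem lt_timestamp_iff (hc : ∀ e, Monotone (c e))
    (hrc : ∀ e t, ContinuousWithinAt (c e) (Set.Ici t) t) {s : ℕ → ℝ≥0} (hs : Monotone s) {n : ℕ}
    (hn : s 0 < s n)
    (hone : ∀ k < n, ∀ e f, c e (s k) < c e (s (k + 1)) → c f (s k) < c f (s (k + 1)) → e = f)
    (v : N) :
    s 0 < G.timestamp c (s n) v ↔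
      v ∈ G.spreadSeq {G.source} (fun k e => c e (s k) < c e (s (k + 1))) n := by
  classical
  have key : ∀ k ≤ n, G.later (s 0) ((G.eventList c (s k)).foldl (G.step c) fun _ => 0) =
      G.spreadSeq {G.source} (fun k e => c e (s k) < c e (s (k + 1))) k := fun k => by
    induction k with
    | zero =>
      intro _
      ext u
      -- No timestamp at time `s 0` exceeds `s 0`, so only the source counts at the start.
      have : G.eventList c (s 0) |>.foldl (G.step c) (fun _ => 0) |> (· u ≤ s 0) :=
        foldl_step_le (fun r hr => le_of_mem_eventList hr) (fun _ => zero_le) u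
      simpa [GossipNetwork.later, WeightedDigraph.spreadSeq] using fun h => absurd this (not_le.2 h)
    | succ k ih =>
      intro hk
      rw [later_eventList hc hrc (hs k.zero_le) (hs k.le_succ) (hone k hk), ih (by lia)]
      rfl
  rw [← key n le_rfl, GossipNetwork.timestamp, Function.update_apply]
  split_ifs with hv <;> simp [GossipNetwork.later, hv, hn]

end Network

/-! ### Path reversal and passage times from the source -/

section Reverse

variable {N : Type*} (G : WeightedDigraph N)

/-- The edges of the reversed graph correspond to those of the graph. -/
def WeightedDigraph.reverseEdge : G.Edge ≃ G.reverse.Edge where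
  toFun e := ⟨(e.1.2, e.1.1), e.2⟩
  invFun e := ⟨(e.1.2, e.1.1), e.2⟩
  left_inv _ := rfl
  right_inv _ := rfl

variable {G}

theorem isPath_reverse (γ : List G.Edge) (u v : N) :
    G.reverse.IsPath (γ.map G.reverseEdge).reverse v u ↔ G.IsPath γ u v := by
  induction γ generalizing u with
  | nil => exact eq_comm
  | cons e γ ih =>
    rw [List.map_cons, List.reverse_cons, WeightedDigraph.isPath_append]
    simp only [ih, WeightedDigraph.IsPath]
    simp only [WeightedDigraph.reverseEdge, Equiv.coe_fn_mk]
    grind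

theorem pathTime_reverse (τ : G.reverse.Edge → ℝ) (γ : List G.Edge) :
    G.reverse.pathTime τ (γ.map G.reverseEdge).reverse =
      G.pathTime (fun e => τ (G.reverseEdge e)) γ := by
  simp [WeightedDigraph.pathTime, List.map_reverse, List.sum_reverse, Function.comp_def]

theorem passageTime_reverse (τ : G.reverse.Edge → ℝ) (u v : N) :
    G.reverse.passageTime τ v u = G.passageTime (fun e => τ (G.reverseEdge e)) u v := by
  unfold WeightedDigraph.passageTime
  congr 1
  ext x
  constructor
  · rintro ⟨γ, hγ, rfl⟩
    have hγ' : ((γ.reverse.map G.reverseEdge.symm).map G.reverseEdge).reverse = γ := by simp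
    refine ⟨γ.reverse.map G.reverseEdge.symm, ?_, ?_⟩
    · rwa [← isPath_reverse, hγ']
    · rw [← pathTime_reverse, hγ']
  · rintro ⟨γ, hγ, rfl⟩
    exact ⟨_, (isPath_reverse γ u v).2 hγ, pathTime_reverse τ γ⟩

/-- The infimum is attained. Reachability matters: the infimum over an empty set of paths would be
0. -/
theorem passageTime_le_iff [Finite N] {τ : G.Edge → ℝ} (hτ : ∀ e, 0 ≤ τ e) {u v : N}
    (h : ∃ γ, G.IsPath γ u v) (x : ℝ) :
    G.passageTime τ u v ≤ x ↔ G.ReachedBy τ {u} v x := by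
  have hl := G.isLeast_passageTime τ hτ u v h
  constructor
  · intro hx
    obtain ⟨γ, hγ, hγx⟩ := hl.1
    exact ⟨u, rfl, γ, hγ, hγx.trans_le hx⟩
  · rintro ⟨_, rfl, γ, hγ, hγx⟩
    exact (hl.2 ⟨γ, hγ, rfl⟩).trans hγx

theorem GossipNetwork.exists_isPath (G : GossipNetwork N) (v : N) :
    ∃ γ, G.IsPath γ G.source v := by
  by_cases hv : v = G.source
  · exact ⟨[], hv.symm⟩
  · exact ⟨[⟨(G.source, v), G.source_adj v hv⟩], rfl, rfl⟩

end Reverse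

/-! ### Spreading along Poisson clocks -/

theorem measure_prop_ext {μ ν : Measure Prop} [IsProbabilityMeasure μ] [IsProbabilityMeasure ν]
    (h : μ {True} = ν {True}) : μ = ν := by
  refine Measure.ext_of_singleton fun p => ?_
  by_cases hp : p
  · rwa [eq_true hp]
  · have hF : ({p} : Set Prop) = {True}ᶜ := by
      ext q
      by_cases hq : q <;> simp [hp, hq]
    rw [hF, prob_compl_eq_one_sub (measurableSet_singleton _),
      prob_compl_eq_one_sub (measurableSet_singleton _), h]

theorem lintegral_eq_of_indepFun {Ω α β : Type*} [MeasurableSpace Ω] [MeasurableSpace α]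
    [MeasurableSpace β] {P : Measure Ω} [IsProbabilityMeasure P] {X : Ω → α} {Y : Ω → β}
    (hX : Measurable X) (hY : Measurable Y) (hXY : IndepFun X Y P) {f : α → β → ℝ≥0∞}
    (hf : Measurable (Function.uncurry f)) :
    ∫⁻ ω, f (X ω) (Y ω) ∂P = ∫⁻ ω, ∫⁻ y, f (X ω) y ∂P.map Y ∂P := by
  have := Measure.isProbabilityMeasure_map (μ := P) hY.aemeasurable
  have h := (indepFun_iff_map_prod_eq_prod_map_map hX.aemeasurable hY.aemeasurable).1 hXY
  calc ∫⁻ ω, f (X ω) (Y ω) ∂P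
      = ∫⁻ p, Function.uncurry f p ∂P.map (fun ω => (X ω, Y ω)) :=
        (lintegral_map hf (hX.prodMk hY)).symm
    _ = ∫⁻ x, ∫⁻ y, f x y ∂P.map Y ∂P.map X := by
        rw [h, lintegral_prod _ hf.aemeasurable]
        rfl
    _ = _ := lintegral_map hf.lintegral_prod_right' hX

section Poisson

variable {N Ω : Type*} [MeasurableSpace Ω] {G : WeightedDigraph N}
  {C : G.Edge → ℝ≥0 → Ω → ℕ} {P : Measure Ω}

/-- The edges whose clocks ring in the `k`-th of the successive windows of length `h` after `a`. -/
def windowRings (C : G.Edge → ℝ≥0 → Ω → ℕ) (a h : ℝ≥0) (ω : Ω) (k : ℕ) (e : G.Edge) : Prop :=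
  C e (a + k * h) ω < C e (a + (k + 1 : ℕ) * h) ω

theorem monotone_window (a h : ℝ≥0) : Monotone fun k : ℕ => a + k * h := fun _ _ hkl => by
  dsimp only
  gcongr

theorem measurable_windowRings (hC : IsPoissonClocks G C P) (a h : ℝ≥0) (k : ℕ) (e : G.Edge) :
    Measurable fun ω => windowRings C a h ω k e :=
  measurableSet_setOfPred.1 (measurableSet_lt ((hC.poisson e).measurable _)
    ((hC.poisson e).measurable _))

theorem spreadSeq_congr (S : Set N) {R R' : ℕ → G.Edge → Prop} {k : ℕ}
    (h : ∀ j < k, R j = R' j) : G.spreadSeq S R k = G.spreadSeq S R' k := by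
  induction k with
  | zero => rfl
  | succ k ih =>
    simp only [WeightedDigraph.spreadSeq]
    rw [ih fun j hj => h j (by lia), h k (by lia)]

/-- Independence of the clocks handles different edges, independence of increments handles different
windows of one edge. -/
theorem iIndepFun_windowRings (hC : IsPoissonClocks G C P) (a h : ℝ≥0) :
    iIndepFun (fun (p : G.Edge × ℕ) ω => windowRings C a h ω p.2 p.1) P := by
  refine iIndepFun_uncurry' (X := fun e k ω => windowRings C a h ω k e)
    (fun e k => measurable_windowRings hC a h k e) ?_ fun e => ?_
  · refine hC.indep.comp (fun _ c (k : ℕ) => c (a + k * h) < c (a + (k + 1 : ℕ) * h)) fun e => ?_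
    exact measurable_pi_lambda _ fun k => measurableSet_setOfPred.1
      (measurableSet_lt (measurable_pi_apply _) (measurable_pi_apply _))
  · have := ((hC.poisson e).indep_increments.nat (monotone_window a h)).comp
      (fun _ d => 0 < d) fun _ => measurable_of_countable _
    convert this using 3
    simp [windowRings]

theorem measure_windowRings [IsProbabilityMeasure P] (hC : IsPoissonClocks G C P)
    (a h : ℝ≥0) (k : ℕ) (e : G.Edge) :
    P {ω | windowRings C a h ω k e} =
      ENNReal.ofReal (1 - Real.exp (-(G.rate e.1.1 e.1.2 * h))) := by
  have hs : a + k * h ≤ a + (k + 1 : ℕ) * h := monotone_window a h k.le_succ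
  have hlaw := (hC.poisson e).increment_law _ _ hs
  have hsub : a + (k + 1 : ℕ) * h - (a + k * h) = h := by
    rw [add_tsub_add_eq_tsub_left]
    push_cast
    rw [add_mul, one_mul, add_tsub_cancel_left]
  rw [hsub] at hlaw
  have h0 := hlaw.measure_eq (p := (· = 0)) (measurableSet_singleton 0)
  -- Truncated subtraction vanishes exactly when the count does not grow, so monotonicity of the
  -- clock is not needed.
  have hset : {ω | windowRings C a h ω k e} =
      {ω | C e (a + (k + 1 : ℕ) * h) ω - C e (a + k * h) ω = 0}ᶜ := by
    ext ω
    simp only [windowRings, Set.mem_ofPred_eq, Set.mem_compl_iff]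
    lia
  have hm : MeasurableSet {ω | C e (a + (k + 1 : ℕ) * h) ω - C e (a + k * h) ω = 0} :=
    (((hC.poisson e).measurable _).sub ((hC.poisson e).measurable _)) (measurableSet_singleton 0)
  have hp : poissonMeasure (G.rate e.1.1 e.1.2 * h) {x | x = 0} =
      ENNReal.ofReal (Real.exp (-(G.rate e.1.1 e.1.2 * h))) := by
    rw [show {x : ℕ | x = 0} = {0} from rfl, poissonMeasure_singleton]
    simp
  rw [hset, prob_compl_eq_one_sub hm, h0, hp, ← ENNReal.ofReal_one,
    ← ENNReal.ofReal_sub _ (Real.exp_pos _).le]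

variable [Fintype N]

theorem measurable_spreadSeq (hC : IsPoissonClocks G C P) (a h : ℝ≥0) (S : Set N) (k : ℕ) :
    Measurable fun ω => G.spreadSeq S (windowRings C a h ω) k := by
  induction k with
  | zero => exact measurable_const
  | succ k ih =>
    exact (measurable_of_countable fun p : Set N × (G.Edge → Prop) => G.spread p.1 p.2).comp
      (ih.prodMk (measurable_pi_lambda _ fun e => measurable_windowRings hC a h k e))

theorem measurableSet_mem_spreadSeq (hC : IsPoissonClocks G C P) (a h : ℝ≥0) (v : N) (S : Set N)
    (k : ℕ) : MeasurableSet {ω | v ∈ G.spreadSeq S (windowRings C a h ω) k} :=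
  measurable_spreadSeq hC a h S k (Set.to_countable {A : Set N | v ∈ A}).measurableSet

/-- In some of the first `n` windows of length `h` after `a`, at least two clocks ring. -/
def clash (C : G.Edge → ℝ≥0 → Ω → ℕ) (a h : ℝ≥0) (n : ℕ) : Set Ω :=
  ⋃ k ∈ Finset.range n, ⋃ e, ⋃ f, ⋃ _ : e ≠ f,
    {ω | windowRings C a h ω k e} ∩ {ω | windowRings C a h ω k f}

theorem measurableSet_clash (hC : IsPoissonClocks G C P) (a h : ℝ≥0) (n : ℕ) :
    MeasurableSet (clash C a h n) :=
  Finset.measurableSet_biUnion _ fun k _ => .iUnion fun e => .iUnion fun f => .iUnion fun _ =>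
    (measurableSet_setOfPred.2 (measurable_windowRings hC a h k e)).inter
      (measurableSet_setOfPred.2 (measurable_windowRings hC a h k f))

theorem indepFun_spreadSeq (hC : IsPoissonClocks G C P) (a h : ℝ≥0) (S : Set N) (k : ℕ) :
    IndepFun (fun ω => G.spreadSeq S (windowRings C a h ω) k)
      (fun ω => windowRings C a h ω k) P := by
  classical
  have hd : Disjoint (Finset.univ ×ˢ Finset.range k : Finset (G.Edge × ℕ))
      (Finset.univ ×ˢ {k}) := by
    rw [Finset.disjoint_left]
    simp only [Finset.mem_product, Finset.mem_range, Finset.mem_singleton]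
    lia
  have hi := (iIndepFun_windowRings hC a h).indepFun_finset _ _ hd
    fun p => measurable_windowRings hC a h p.2 p.1
  -- The first k rounds read only windows before k; `False` is a filler for later windows and is
  -- never read.
  have := hi.comp
    (φ := fun z => G.spreadSeq S (fun j e => if hj : (e, j) ∈
      (Finset.univ ×ˢ Finset.range k : Finset (G.Edge × ℕ)) then z ⟨_, hj⟩ else False) k)
    (ψ := fun z e => z ⟨(e, k), by simp⟩)
    (measurable_of_countable _) (measurable_of_countable _)
  convert this using 1
  · ext1 ω
    refine spreadSeq_congr S fun j hj => ?_
    ext e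
    simp [hj]
  · rfl

variable [IsProbabilityMeasure P]

/-- The link between clocks and weights: for a rate w, a Poisson variable of mean wh is nonzero, and
an exponential variable is at most h, with the same probability 1 - exp(-wh). -/
theorem map_windowRings (hC : IsPoissonClocks G C P) (a h : ℝ≥0) (k : ℕ) :
    P.map (fun ω => windowRings C a h ω k) = G.ringLaw h := by
  have hi : iIndepFun (fun e ω => windowRings C a h ω k e) P :=
    (iIndepFun_windowRings hC a h).precomp (g := fun e => (e, k)) fun _ _ h => (Prod.ext_iff.1 h).1
  have hle : Measurable fun x : ℝ => x ≤ h :=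
    measurableSet_setOfPred.1 (measurableSet_le measurable_id measurable_const)
  have (e : G.Edge) := Measure.isProbabilityMeasure_map
    (μ := expMeasure (G.rate e.1.1 e.1.2)) hle.aemeasurable
  refine (hi.map_fun_eq_pi_map fun e => (measurable_windowRings hC a h k e).aemeasurable).trans ?_
  rw [WeightedDigraph.ringLaw, WeightedDigraph.weightLaw,
    Measure.pi_map_pi (f := fun _ x => x ≤ (h : ℝ)) fun e => hle.aemeasurable]
  congr 1
  ext1 e
  have := Measure.isProbabilityMeasure_map (μ := P)
    (measurable_windowRings hC a h k e).aemeasurable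
  refine measure_prop_ext ?_
  rw [Measure.map_apply (measurable_windowRings hC a h k e) (measurableSet_singleton _),
    Measure.map_apply hle (measurableSet_singleton _)]
  have h1 : (fun x : ℝ => x ≤ h) ⁻¹' {True} = Set.Iic (h : ℝ) := by ext; simp
  have h2 : (fun ω => windowRings C a h ω k e) ⁻¹' {True} = {ω | windowRings C a h ω k e} := by
    ext; simp
  rw [h1, h2, measure_windowRings hC, expMeasure_Iic (NNReal.coe_pos.2 (G.rate_pos e.2)),
    if_pos (NNReal.coe_nonneg h)]

/-- `spreadProb` recurses on the first round and `spreadSeq` on the last. Mixing k actual windows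
with m averaged rounds reconciles them: the last actual window is independent of the past and can be
averaged out. -/
theorem lintegral_spreadProb_spreadSeq (hC : IsPoissonClocks G C P) (a h : ℝ≥0) (v : N)
    (S : Set N) (k m : ℕ) :
    ∫⁻ ω, G.spreadProb h v m (G.spreadSeq S (windowRings C a h ω) k) ∂P =
      G.spreadProb h v (m + k) S := by
  induction k generalizing m with
  | zero => simp [WeightedDigraph.spreadSeq]
  | succ k ih =>
    simp only [WeightedDigraph.spreadSeq]
    rw [lintegral_eq_of_indepFun (f := fun A R => G.spreadProb h v m (G.spread A R))
      (measurable_spreadSeq hC a h S k)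
      (measurable_pi_lambda _ fun e => measurable_windowRings hC a h k e)
      (indepFun_spreadSeq hC a h S k) (measurable_of_countable _), map_windowRings hC]
    rw [← Nat.add_assoc, Nat.add_right_comm, ← ih (m + 1)]
    rfl

theorem measure_mem_spreadSeq (hC : IsPoissonClocks G C P) (a h : ℝ≥0) (v : N) (S : Set N)
    (n : ℕ) : P {ω | v ∈ G.spreadSeq S (windowRings C a h ω) n} = G.spreadProb h v n S := by
  have := lintegral_spreadProb_spreadSeq hC a h v S n 0
  rw [zero_add] at this
  rw [← this, ← lintegral_indicator_one (measurableSet_mem_spreadSeq hC a h v S n)]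
  refine lintegral_congr fun ω => ?_
  by_cases hv : v ∈ G.spreadSeq S (windowRings C a h ω) n
  · simp [WeightedDigraph.spreadProb, hv]
  · rw [Set.indicator_of_notMem (by exact hv)]
    simp [WeightedDigraph.spreadProb, hv]

/-- Union bound over windows and pairs of edges, with independence and 1 - exp(-z) ≤ z for each
pair. -/
theorem measure_clash_le (hC : IsPoissonClocks G C P) (a h : ℝ≥0) (n : ℕ) :
    P (clash C a h n) ≤ n * ∑ e : G.Edge, ∑ f : G.Edge,
      ((G.rate e.1.1 e.1.2 * h * (G.rate f.1.1 f.1.2 * h) : ℝ≥0) : ℝ≥0∞) := by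
  have hle : ∀ k (e : G.Edge), P {ω | windowRings C a h ω k e} ≤
      ((G.rate e.1.1 e.1.2 * h : ℝ≥0) : ℝ≥0∞) := fun k e => by
    rw [measure_windowRings hC, ← ENNReal.ofReal_coe_nnreal]
    refine ENNReal.ofReal_le_ofReal ?_
    push_cast
    linarith [Real.add_one_le_exp (-(G.rate e.1.1 e.1.2 * h : ℝ))]
  have hpair : ∀ k (e f : G.Edge), P (⋃ _ : e ≠ f, {ω | windowRings C a h ω k e} ∩
      {ω | windowRings C a h ω k f}) ≤
      ((G.rate e.1.1 e.1.2 * h * (G.rate f.1.1 f.1.2 * h) : ℝ≥0) : ℝ≥0∞) := fun k e f => by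
    by_cases hef : e = f
    · simp [hef]
    · have hi := (iIndepFun_windowRings hC a h).indepFun
        (show (e, k) ≠ (f, k) from fun h => hef (Prod.ext_iff.1 h).1)
      have h2 : ∀ e, {ω | windowRings C a h ω k e} =
          (fun ω => windowRings C a h ω k e) ⁻¹' {True} := fun e => by ext; simp
      simp only [ne_eq, hef, not_false_eq_true, Set.iUnion_true]
      rw [h2 e, h2 f, hi.measure_inter_preimage_eq_mul _ _ (measurableSet_singleton _)
        (measurableSet_singleton _), ← h2 e, ← h2 f, ENNReal.coe_mul]
      exact mul_le_mul' (hle k e) (hle k f)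
  refine (measure_biUnion_finset_le _ _).trans ?_
  refine (Finset.sum_le_card_nsmul _ _ _ fun k _ => ?_).trans_eq
    (by rw [Finset.card_range, nsmul_eq_mul])
  refine (measure_iUnion_fintype_le _ _).trans (Finset.sum_le_sum fun e _ => ?_)
  exact (measure_iUnion_fintype_le _ _).trans (Finset.sum_le_sum fun f _ => hpair k e f)

theorem tendsto_measure_clash (hC : IsPoissonClocks G C P) (a x : ℝ≥0) :
    Tendsto (fun n : ℕ => P (clash C a (x / n) n)) atTop (𝓝 0) := by
  -- Since n (x/n)² = x²/n, the clash bound is `K / n`.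
  let K : ℝ≥0 := ∑ e : G.Edge, ∑ f : G.Edge,
    G.rate e.1.1 e.1.2 * x * (G.rate f.1.1 f.1.2 * x)
  have hlim : Tendsto (fun n : ℕ => ((K / n : ℝ≥0) : ℝ≥0∞)) atTop (𝓝 0) :=
    ENNReal.tendsto_coe.2 (tendsto_const_div_atTop_nhds_zero_nat K)
  refine tendsto_of_tendsto_of_tendsto_of_le_of_le' tendsto_const_nhds hlim
    (Eventually.of_forall fun _ => zero_le) ?_
  filter_upwards [eventually_gt_atTop 0] with n hn
  refine (measure_clash_le hC a (x / n) n).trans_eq ?_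
  have hn' : (n : ℝ≥0) ≠ 0 := by positivity
  simp only [← ENNReal.ofNNReal_finsetSum]
  rw [← ENNReal.coe_natCast, ← ENNReal.coe_mul, ENNReal.coe_inj]
  simp only [K, Finset.mul_sum, Finset.sum_div]
  refine Finset.sum_congr rfl fun e _ => Finset.sum_congr rfl fun f _ => ?_
  field_simp

end Poisson

/-! ### Passing to the limit of fine windows -/

section Age

variable {N Ω : Type*} [Fintype N] [MeasurableSpace Ω] {G : GossipNetwork N}
  {C : G.Edge → ℝ≥0 → Ω → ℕ} {P : Measure Ω}

theorem ae_lt_timestamp_iff (hC : IsPoissonClocks G.toWeightedDigraph C P) (a : ℝ≥0) {x : ℝ≥0}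
    (hx : 0 < x) (v : N) :
    ∀ᵐ ω ∂P, ∀ n : ℕ, 0 < n → ω ∉ clash C a (x / n) n →
      (a < G.timestamp (fun e s => C e s ω) (a + x) v ↔
        v ∈ G.spreadSeq {G.source} (windowRings C a (x / n) ω) n) := by
  have h1 : ∀ᵐ ω ∂P, ∀ e, Monotone fun t => C e t ω := ae_all_iff.2 fun e => (hC.poisson e).mono
  have h2 : ∀ᵐ ω ∂P, ∀ e t, ContinuousWithinAt (fun s => C e s ω) (Set.Ici t) t :=
    ae_all_iff.2 fun e => (hC.poisson e).right_continuous
  filter_upwards [h1, h2] with ω h1 h2 n hn hclash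
  have hn' : (n : ℝ≥0) ≠ 0 := by positivity
  have hsn : a + n * (x / n) = a + x := by rw [mul_div_cancel₀ _ hn']
  have := lt_timestamp_iff (G := G) (c := fun e s => C e s ω) h1 h2
    (monotone_window a (x / n)) (n := n) (by simp only [hsn]; simpa using hx)
    (fun k hk e f he hf => by
      by_contra hef
      refine hclash ?_
      simp only [clash, Set.mem_iUnion]
      exact ⟨k, Finset.mem_range.2 hk, e, f, hef, he, hf⟩) v
  simp only [hsn, Nat.cast_zero, zero_mul, add_zero] at this
  exact this

variable [IsProbabilityMeasure P]

/-- Almost surely some n > 0 has no clash, because the clash probabilities tend to 0. Up to a null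
set the event is thus a countable union of events described by finitely many clock values. -/
theorem nullMeasurableSet_lt_timestamp (hC : IsPoissonClocks G.toWeightedDigraph C P) (a : ℝ≥0)
    {x : ℝ≥0} (hx : 0 < x) (v : N) :
    NullMeasurableSet {ω | a < G.timestamp (fun e s => C e s ω) (a + x) v} P := by
  have hnull : ∀ᵐ ω ∂P, ∃ n : ℕ, 0 < n ∧ ω ∉ clash C a (x / n) n := by
    refine measure_mono_null (t := ⋂ n ∈ {n : ℕ | 0 < n}, clash C a (x / n) n) ?_ ?_
    · intro ω hω
      have hω : ¬ ∃ n : ℕ, 0 < n ∧ ω ∉ clash C a (x / n) n := hω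
      push Not at hω
      exact Set.mem_iInter₂.2 hω
    · refine nonpos_iff_eq_zero.1 (ge_of_tendsto (tendsto_measure_clash hC a x) ?_)
      filter_upwards [eventually_gt_atTop 0] with n hn
      exact measure_mono (Set.biInter_subset_of_mem hn)
  refine NullMeasurableSet.congr (s := ⋃ n ∈ {n : ℕ | 0 < n},
    {ω | v ∈ G.spreadSeq {G.source} (windowRings C a (x / n) ω) n} \ clash C a (x / n) n)
    (MeasurableSet.nullMeasurableSet ?_) ?_
  · exact MeasurableSet.biUnion (Set.to_countable _) fun n _ =>
      (measurableSet_mem_spreadSeq hC _ _ _ _ _).diff (measurableSet_clash hC _ _ _)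
  · rw [eventuallyEq_set]
    filter_upwards [ae_lt_timestamp_iff hC a hx v, hnull] with ω hω ⟨n, hn, hclash⟩
    simp only [Set.mem_iUnion, Set.mem_sdiff, Set.mem_ofPred_eq]
    constructor
    · rintro ⟨m, hm, hmem, hclash'⟩
      exact (hω m hm hclash').2 hmem
    · exact fun h => ⟨n, hn, (hω n hn hclash).1 h, hclash⟩

theorem measure_lt_timestamp_le (hC : IsPoissonClocks G.toWeightedDigraph C P) (a : ℝ≥0)
    {x : ℝ≥0} (hx : 0 < x) (v : N) :
    P {ω | a < G.timestamp (fun e s => C e s ω) (a + x) v} ≤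
      G.weightLaw {τ | G.ReachedBy τ {G.source} v x} := by
  have hlim := (tendsto_measure_clash hC a x).const_add
    (G.weightLaw {τ | G.ReachedBy τ {G.source} v x})
  rw [add_zero] at hlim
  refine ge_of_tendsto hlim ?_
  filter_upwards [eventually_gt_atTop 0] with n hn
  have hn' : (n : ℝ) ≠ 0 := by positivity
  have hle := spreadProb_le (G := G.toWeightedDigraph) v (x / n : ℝ≥0).2 n {G.source}
  have hnx : (n : ℝ) * (x / n : ℝ≥0) = x := by
    push_cast
    exact mul_div_cancel₀ _ hn'
  simp only [NNReal.val_eq_coe, hnx, ← measure_mem_spreadSeq hC a] at hle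
  refine le_trans ?_ (add_le_add_left hle _)
  refine le_trans (measure_mono_ae ?_) (measure_union_le _ _)
  filter_upwards [ae_lt_timestamp_iff hC a hx v] with ω hω h
  by_cases hclash : ω ∈ clash C a (x / n) n
  · exact Or.inr hclash
  · exact Or.inl ((hω n hn hclash).1 h)

/-- The gap between y and x absorbs the rounding loss `K * x / n` once n is large. -/
theorem le_measure_lt_timestamp (hC : IsPoissonClocks G.toWeightedDigraph C P) (a : ℝ≥0)
    {x : ℝ≥0} (hx : 0 < x) (v : N) {y : ℝ} (hy : y < x) :
    G.weightLaw {τ | G.ReachedBy τ {G.source} v y} ≤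
      P {ω | a < G.timestamp (fun e s => C e s ω) (a + x) v} := by
  have hlim := (tendsto_measure_clash hC a x).const_add
    (P {ω | a < G.timestamp (fun e s => C e s ω) (a + x) v})
  rw [add_zero] at hlim
  let K : ℝ := ({G.source}ᶜ : Set N).ncard
  have hlim' : Tendsto (fun n : ℕ => (x : ℝ) - K * x / n) atTop (𝓝 x) := by
    simpa using (tendsto_const_div_atTop_nhds_zero_nat (K * x)).const_sub (x : ℝ)
  refine ge_of_tendsto hlim ?_
  filter_upwards [eventually_gt_atTop 0, hlim'.eventually (lt_mem_nhds hy)] with n hn hyn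
  have hn' : (n : ℝ) ≠ 0 := by positivity
  have hle := weightLaw_reachedBy_le_spreadProb (G := G.toWeightedDigraph) v
    (h := (x / n : ℝ≥0)) (by positivity) n {G.source} y (hyn.le.trans_eq (by
      push_cast
      simp only [K]
      field_simp))
  rw [← measure_mem_spreadSeq hC a] at hle
  refine hle.trans ?_
  refine le_trans (measure_mono_ae ?_) (measure_union_le _ _)
  filter_upwards [ae_lt_timestamp_iff hC a hx v] with ω hω h
  by_cases hclash : ω ∈ clash C a (x / n) n
  · exact Or.inr hclash
  · exact Or.inl ((hω n hn hclash).2 h)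

end Age

/-! ### Identification of the laws -/

/-- Right-continuity of distribution functions removes the slack y < x. -/
theorem measure_eq_of_Iic_le {μ ν : Measure ℝ} [IsProbabilityMeasure μ] [IsProbabilityMeasure ν]
    (h : ∀ y x, y < x → μ (Set.Iic y) ≤ ν (Set.Iic x))
    (h' : ∀ y x, y < x → ν (Set.Iic y) ≤ μ (Set.Iic x)) : μ = ν := by
  have key : ∀ {μ ν : Measure ℝ} [IsProbabilityMeasure μ] [IsProbabilityMeasure ν],
      (∀ y x, y < x → μ (Set.Iic y) ≤ ν (Set.Iic x)) → ∀ y, cdf μ y ≤ cdf ν y := by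
    intro μ ν _ _ h y
    have hlim : Tendsto (cdf ν) (𝓝[>] y) (𝓝 (cdf ν y)) :=
      ((cdf ν).right_continuous y).mono_left (nhdsWithin_mono y Set.Ioi_subset_Ici_self)
    refine ge_of_tendsto hlim ?_
    filter_upwards [self_mem_nhdsWithin] with x hx
    rw [cdf_eq_real, cdf_eq_real]
    exact ENNReal.toReal_mono (measure_ne_top _ _) (h y x hx)
  refine Measure.eq_of_cdf _ _ (StieltjesFunction.ext fun y => le_antisymm (key h y) (key h' y))

section

variable {N Ω : Type*} [Fintype N] [MeasurableSpace Ω] {G : GossipNetwork N} {P : Measure Ω}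

theorem map_weights {τ : G.reverse.Edge → Ω → ℝ} (hτ : IsExponentialWeights G.reverse τ P) :
    AEMeasurable (fun ω e => τ (G.reverseEdge e) ω) P ∧
      P.map (fun ω e => τ (G.reverseEdge e) ω) = G.weightLaw := by
  have hm : ∀ e, AEMeasurable (τ (G.reverseEdge e)) P := fun e => (hτ.law _).aemeasurable
  refine ⟨aemeasurable_pi_lambda _ hm, ?_⟩
  refine ((hτ.indep.precomp G.reverseEdge.injective).map_fun_eq_pi_map hm).trans ?_
  rw [WeightedDigraph.weightLaw]
  congr 1
  ext1 e
  exact (hτ.law (G.reverseEdge e)).map_eq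

theorem ae_passageTime {τ : G.reverse.Edge → Ω → ℝ} (hτ : IsExponentialWeights G.reverse τ P)
    (v : N) : ∀ᵐ ω ∂P, ∀ x, G.reverse.passageTime (fun e => τ e ω) v G.source ≤ x ↔
      G.ReachedBy (fun e => τ (G.reverseEdge e) ω) {G.source} v x := by
  obtain ⟨hm, hmap⟩ := map_weights hτ
  have h0 : ∀ᵐ ω ∂P, ∀ e, 0 ≤ τ (G.reverseEdge e) ω := by
    refine ae_of_ae_map hm (p := fun σ : G.Edge → ℝ => ∀ e, 0 ≤ σ e) ?_
    rw [hmap]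
    exact ae_nonneg_weightLaw
  filter_upwards [h0] with ω hω x
  rw [passageTime_reverse]
  exact passageTime_le_iff hω (G.exists_isPath v) x

theorem measure_passageTime_le {τ : G.reverse.Edge → Ω → ℝ}
    (hτ : IsExponentialWeights G.reverse τ P) (v : N) (x : ℝ) :
    P {ω | G.reverse.passageTime (fun e => τ e ω) v G.source ≤ x} =
      G.weightLaw {σ | G.ReachedBy σ {G.source} v x} := by
  obtain ⟨hm, hmap⟩ := map_weights hτ
  rw [← hmap, Measure.map_apply_of_aemeasurable hm (measurableSet_reachedBy _ _ _)]
  refine measure_congr (eventuallyEq_set.2 ?_)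
  filter_upwards [ae_passageTime hτ v] with ω hω
  exact hω x

theorem aemeasurable_passageTime {τ : G.reverse.Edge → Ω → ℝ}
    (hτ : IsExponentialWeights G.reverse τ P) (v : N) :
    AEMeasurable (fun ω => G.reverse.passageTime (fun e => τ e ω) v G.source) P := by
  obtain ⟨hm, -⟩ := map_weights hτ
  refine NullMeasurable.aemeasurable (measurable_of_Iic (δ := NullMeasurableSpace Ω P) fun x => ?_)
  refine NullMeasurableSet.congr (hm.nullMeasurable (measurableSet_reachedBy {G.source} v x)) ?_
  refine eventuallyEq_set.2 ?_
  filter_upwards [ae_passageTime hτ v] with ω hω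
  exact (hω x).symm

theorem age_lt_iff {c : G.Edge → ℝ≥0 → ℕ} {a x : ℝ≥0} {v : N} :
    G.age c (a + x) v < x ↔ a < G.timestamp c (a + x) v := by
  rw [GossipNetwork.age, ← NNReal.coe_lt_coe]
  push_cast
  constructor <;> intro <;> linarith

variable {C : G.Edge → ℝ≥0 → Ω → ℕ} [IsProbabilityMeasure P]

theorem aemeasurable_age (hC : IsPoissonClocks G.toWeightedDigraph C P) (t : ℝ≥0) (v : N) :
    AEMeasurable (fun ω => G.age (fun e s => C e s ω) t v) P := by
  refine NullMeasurable.aemeasurable (measurable_of_Iio (δ := NullMeasurableSpace Ω P) fun x => ?_)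
  change NullMeasurableSet {ω | G.age (fun e s => C e s ω) t v < x} P
  rcases le_or_gt x 0 with hx | hx
  · simp [not_lt.2 (hx.trans (age_nonneg _ _))]
  rcases lt_or_ge (t : ℝ) x with hxt | hxt
  · simp [(age_le _ _).trans_lt hxt]
  lift x to ℝ≥0 using hx.le
  obtain ⟨a, rfl⟩ := exists_add_of_le (NNReal.coe_le_coe.1 hxt)
  rw [add_comm x a]
  simp only [age_lt_iff]
  exact nullMeasurableSet_lt_timestamp hC a (NNReal.coe_pos.1 hx) v

theorem identDistrib_age (hC : IsPoissonClocks G.toWeightedDigraph C P) {Ω' : Type*}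
    [MeasurableSpace Ω'] {P' : Measure Ω'} [IsProbabilityMeasure P'] {τ : G.reverse.Edge → Ω' → ℝ}
    (hτ : IsExponentialWeights G.reverse τ P') (v : N) (t : ℝ≥0) :
    IdentDistrib (fun ω => G.age (fun e s => C e s ω) t v)
      (fun ω' => min (G.reverse.passageTime (fun e => τ e ω') v G.source) (t : ℝ)) P P' := by
  have hX := aemeasurable_age hC t v
  have hT := (aemeasurable_passageTime hτ v).min (aemeasurable_const (b := (t : ℝ)))
  refine ⟨hX, hT, ?_⟩
  have := Measure.isProbabilityMeasure_map hX
  have := Measure.isProbabilityMeasure_map hT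
  refine measure_eq_of_Iic_le (fun y x hyx => ?_) fun y x hyx => ?_ <;>
    rw [Measure.map_apply_of_aemeasurable hX measurableSet_Iic,
      Measure.map_apply_of_aemeasurable hT measurableSet_Iic]
  · rcases lt_or_ge y 0 with hy | hy
    · refine (measure_mono_null (fun ω hω => ?_) measure_empty).le.trans zero_le
      exact absurd hω (not_le.2 (hy.trans_le (age_nonneg _ _)))
    -- Levels x ≥ t are trivial since both variables are at most t; below t the splitting t = a + x
    -- is available.
    rcases le_or_gt (t : ℝ) x with hxt | hxt
    · refine prob_le_one.trans_eq ?_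
      rw [show _ ⁻¹' Set.Iic x = Set.univ from
        Set.eq_univ_of_forall fun ω => (min_le_right _ _).trans hxt, measure_univ]
    lift x to ℝ≥0 using hy.trans hyx.le
    obtain ⟨a, rfl⟩ := exists_add_of_le (NNReal.coe_le_coe.1 hxt.le)
    rw [add_comm x a]
    have hx : 0 < x := NNReal.coe_pos.1 (hy.trans_lt hyx)
    refine le_trans (measure_mono fun ω hω => ?_) ((measure_lt_timestamp_le hC a hx v).trans ?_)
    · exact age_lt_iff.1 (lt_of_le_of_lt hω hyx)
    · rw [← measure_passageTime_le hτ]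
      exact measure_mono fun ω hω =>
        show min _ ((a + x : ℝ≥0) : ℝ) ≤ x from (min_le_left _ _).trans hω
  · rcases le_or_gt (t : ℝ) x with hxt | hxt
    · refine prob_le_one.trans_eq ?_
      rw [show _ ⁻¹' Set.Iic x = Set.univ from
        Set.eq_univ_of_forall fun ω => (age_le _ _).trans hxt, measure_univ]
    have hle : P' ((fun ω' => min (G.reverse.passageTime (fun e => τ e ω') v G.source) (t : ℝ)) ⁻¹'
        Set.Iic y) ≤ G.weightLaw {σ | G.ReachedBy σ {G.source} v y} := by
      rw [← measure_passageTime_le hτ]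
      exact measure_mono fun ω hω =>
        (min_le_iff.1 hω).resolve_right (not_le.2 (hyx.trans hxt))
    rcases lt_or_ge y 0 with hy | hy
    · rw [weightLaw_reachedBy_of_neg _ _ hy] at hle
      exact hle.trans zero_le
    lift x to ℝ≥0 using hy.trans hyx.le
    obtain ⟨a, rfl⟩ := exists_add_of_le (NNReal.coe_le_coe.1 hxt.le)
    have hx : 0 < x := NNReal.coe_pos.1 (hy.trans_lt hyx)
    refine hle.trans ((le_measure_lt_timestamp hC a hx v hyx).trans ?_)
    rw [add_comm x a]
    exact measure_mono fun ω hω => (age_lt_iff.2 hω).le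

end

end Gossip

theorem theorem1p2 {N : Type*} [Fintype N] (G : Gossip.GossipNetwork N)
    {Ω : Type*} [MeasurableSpace Ω] (P : Measure Ω) [IsProbabilityMeasure P]
    (C : G.Edge → ℝ≥0 → Ω → ℕ) (hC : Gossip.IsPoissonClocks G.toWeightedDigraph C P)
    {Ω' : Type*} [MeasurableSpace Ω'] (P' : Measure Ω') [IsProbabilityMeasure P']
    (τ : G.reverse.Edge → Ω' → ℝ) (hτ : Gossip.IsExponentialWeights G.reverse τ P')
    (v : N) :
    (∀ t : ℝ≥0,
      IdentDistrib (fun ω => G.age (fun e s => C e s ω) t v)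
        (fun ω' => min (G.reverse.passageTime (fun e => τ e ω') v G.source) (t : ℝ)) P P') ∧
    TendstoInDistribution (fun (t : ℝ≥0) ω => G.age (fun e s => C e s ω) t v) atTop
      (fun ω' => G.reverse.passageTime (fun e => τ e ω') v G.source) (fun _ => P) P' := by
  have hid := Gossip.identDistrib_age hC hτ v
  have hT := Gossip.aemeasurable_passageTime hτ v
  have hlim : TendstoInDistribution (fun (t : ℝ≥0) ω' =>
      min (G.reverse.passageTime (fun e => τ e ω') v G.source) (t : ℝ)) atTop
      (fun ω' => G.reverse.passageTime (fun e => τ e ω') v G.source) (fun _ => P') P' := by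
    -- Pointwise, the truncated passage time is eventually constant in t. Convergence in
    -- distribution depends only on the laws, so it then transfers to the ages.
    refine tendstoInDistribution_of_ae_tendsto (fun t => (hid t).aemeasurable_snd) hT
      (ae_of_all _ fun ω => tendsto_const_nhds.congr' ?_)
    filter_upwards [(NNReal.tendsto_coe_atTop.2 tendsto_id).eventually_ge_atTop
      (G.reverse.passageTime (fun e => τ e ω) v G.source)] with t ht
    exact (min_eq_left ht).symm
  refine ⟨hid, fun t => (hid t).aemeasurable_fst, hT, hlim.tendsto.congr fun t => ?_⟩
  exact Subtype.ext (hid t).map_eq.symm
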